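/- **Setting.** A network has $L$ sensors, with observation matrices $\mathbf K_i\in\mathbb C^{J_i\times K}$, channels $\mathbf H_i\in\mathbb C^{M\times N_i}$, source covariance $\mathbf\Sigma_{\mathbf s}\succeq0$, observation noise covariances $\mathbf\Sigma_i\succeq0$, channel noise covariance $\sigma_0^2\mathbf I_M$ with $\sigma_0>0$, and power budgets $P_i>0$. For beamformers $\mathbf F_i\in\mathbb C^{N_i\times J_i}$ and a receiver $\mathbf G\in\mathbb C^{M\times K}$ put $\mathbf T=\sum_{i}\mathbf H_i\mathbf F_i\mathbf K_i$, $\mathbf\Sigma_{\mathbf n}=\sigma_0^2\mathbf I_M+\sum_i\mathbf H_i\mathbf F_i\mathbf\Sigma_i\mathbf F_i^H\mathbf H_i^H$, $\mathbf W_i=\mathbf K_i\mathbf\Sigma_{\mathbf s}\mathbf K_i^H+\mathbf\Sigma_i$ and $$\mathsf{MSE}(\{\mathbf F_i\},\mathbf G)=\mathsf{Tr}\Big\{\mathbf G^H\mathbf T\mathbf\Sigma_{\mathbf s}\mathbf T^H\mathbf G-\mathbf G^H\mathbf T\mathbf\Sigma_{\mathbf s}-\mathbf\Sigma_{\mathbf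 s}\mathbf T^H\mathbf G+\sum_i\mathbf G^H\mathbf H_i\mathbf F_i\mathbf\Sigma_i\mathbf F_i^H\mathbf H_i^H\mathbf G+\sigma_0^2\mathbf G^H\mathbf G+\mathbf\Sigma_{\mathbf s}\Big\}.$$ Problem (P0) is to minimize $\mathsf{MSE}(\{\mathbf F_i\},\mathbf G)$ subject to $\mathsf{Tr}\{\mathbf F_i\mathbf W_i\mathbf F_i^H\}\le P_i$ for all $i$. A feasible point $x_0$ is *stationary* if $\nabla\mathsf{MSE}(x_0)(x-x_0)\ge0$ for all feasible $x$, where $\nabla$ is the real derivative. A limit point of a sequence is the limit of one of its subsequences. **Receiver update.** $\mathbf G=\big(\mathbf T\mathbf\Sigma_{\mathbf s}\mathbf T^H+\mathbf\Sigma_{\mathbf n}\big)^{-1}\mathbf T\mathbf\Sigma_{\mathbf s}$. **Beamformer update.** Write $\mathbf f_i=vec(\mathbf F_i)$, $\mathbf g=vec(\mathbf G)$, $\mathbf A_{ij}=(\mathbf K_j\mathbf\Sigma_{\mathbf s}\mathbf K_i^H)^T\otimes(\mathbf H_i^H\mathbf G\mathbf G^H\mathbf H_j)$, $\mathbf B_i=(\mathbf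 K_i\mathbf\Sigma_{\mathbf s})^T\otimes\mathbf H_i$, $\mathbf C_i=\mathbf\Sigma_i^*\otimes(\mathbf H_i^H\mathbf G\mathbf G^H\mathbf H_i)$, $\mathbf E_i=\mathbf W_i^T\otimes\mathbf I_{N_i}$, $\mathbf q_i=\sum_{j\ne i}\mathbf A_{ij}\mathbf f_j$, $\mathbf c_i=\mathbf B_i^H\mathbf g-\mathbf q_i$. Let $\mathbf M_i=\mathbf E_i^{-1/2}(\mathbf A_{ii}+\mathbf C_i)\mathbf E_i^{-1/2}=\mathbf U\,\mathsf{diag}(\lambda_k)\,\mathbf U^H$ be an eigendecomposition with $\mathbf U$ unitary, and let $\mathbf p=\mathbf U^H\mathbf E_i^{-1/2}\mathbf c_i$. If $p_k=0$ whenever $\lambda_k=0$, and $\sum_{\lambda_k\ne0}|p_k|^2/\lambda_k^2\le P_i$, the new $\mathbf f_i$ is $\mathbf E_i^{-1/2}\mathbf M_i^\dagger\mathbf E_i^{-1/2}\mathbf c_i$, where $\dagger$ is the Moore–Penrose pseudoinverse. Otherwise it is $(\mathbf A_{ii}+\mathbf C_i+\mu\mathbf E_i)^{-1}\mathbf c_i$,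 where $\mu>0$ solves $\sum_k|p_k|^2/(\lambda_k+\mu)^2=P_i$. **Layered BCD algorithm.** Start from any feasible $\{\mathbf F_i^{(0)}\}$, with $\mathbf G^{(0)}$ given by the receiver update. In outer iteration $j+1$, with $\mathbf G=\mathbf G^{(j)}$ fixed, start at $\{\mathbf F_i^{(j)}\}$ and run an inner loop whose passes apply the beamformer update to $i=1,\dots,L$ in turn, always with the latest values of the other beamformers. The result $\{\mathbf F_i^{(j+1)}\}$ is either what is obtained after a finite number (at least one) of passes, under any stopping rule, or a limit point of the sequence of passes if the inner loop is run indefinitely. Then $\mathbf G^{(j+1)}$ is given by the receiver update at $\{\mathbf F_i^{(j+1)}\}$. **Theorem.** Assume that, for every $i\in\{1,\dots,L\}$, $\mathbf K_i\mathbf\Sigma_{\mathbf s}\mathbf K_i^H\succ0$ or $\mathbf\Sigma_i\succ0$. For every sequence $\big(\{\mathbf F_i^{(j)}\},\mathbf G^{(j)}\big)_{j\ge0}$ generated by the layered BCD algorithm, the sequence $\mathsf{MSE}\big(\{\mathbf F_i^{(j)}\},\mathbf G^{(j)}\big)$ is monotonically decreasing (non-increasing), the sequence $\big(\{\mathbf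 F_i^{(j)}\},\mathbf G^{(j)}\big)_j$ has limit points, and every limit point of it is a stationary point of (P0). -/

import Mathlib

open Matrix Filter Topology
open scoped Kronecker ComplexOrder

/-- The data of a coherent multiple-access sensor network with `L` sensors: the fusion centre has
`M` antennas, the source has dimension `K`, and sensor `i` has `N i` antennas and an observation
of dimension `J i`. -/
structure SensorNetwork (L M K : ℕ) (N J : Fin L → ℕ) where
  /-- the observation matrices `K_i` -/
  obs : ∀ i : Fin L, Matrix (Fin (J i)) (Fin K) ℂ
  /-- the channel matrices `H_i` -/
  chan : ∀ i : Fin L, Matrix (Fin M) (Fin (N i)) ℂ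
  /-- the covariance matrix of the source -/
  srcCov : Matrix (Fin K) (Fin K) ℂ
  /-- the covariance matrices of the observation noises -/
  obsCov : ∀ i : Fin L, Matrix (Fin (J i)) (Fin (J i)) ℂ
  /-- the channel noise at the fusion centre has covariance `σ₀ ^ 2 • 1` -/
  σ₀ : ℝ
  /-- the power budgets `P_i` -/
  power : Fin L → ℝ

/-- A family of beamformers `F_i`, one for each sensor. -/
abbrev Beamformers {L : ℕ} (N J : Fin L → ℕ) : Type :=
  ∀ i : Fin L, Matrix (Fin (N i)) (Fin (J i)) ℂ

/-- `x` is a limit point of the sequence `u`: some subsequence of `u` converges to `x`. -/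
def IsLimitPoint {X : Type*} [TopologicalSpace X] (x : X) (u : ℕ → X) : Prop :=
  ∃ φ : ℕ → ℕ, StrictMono φ ∧ Tendsto (fun n => u (φ n)) atTop (𝓝 x)

/-- `x` is a stationary point of the problem of minimizing `f` over the feasible set `S`:
it is feasible, and the (real) derivative of `f` at `x` is nonnegative on `y - x` for all feasible
`y`. -/
def IsStationaryPoint {V : Type*} [AddCommGroup V] [Module ℝ V] [TopologicalSpace V]
    (f : V → ℝ) (S : Set V) (x : V) : Prop :=
  x ∈ S ∧ ∃ f' : V →L[ℝ] ℝ, HasFDerivAt f f' x ∧ ∀ y ∈ S, 0 ≤ f' (y - x)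

/-- `B` is the Moore-Penrose pseudoinverse of `A` (the four Penrose equations). -/
def IsMoorePenroseInverse {m n : Type*} [Fintype m] [Fintype n]
    (A : Matrix m n ℂ) (B : Matrix n m ℂ) : Prop :=
  A * B * A = A ∧ B * A * B = B ∧ (A * B)ᴴ = A * B ∧ (B * A)ᴴ = B * A

namespace SensorNetwork

variable {L M K : ℕ} {N J : Fin L → ℕ}

/-- The compound channel `∑ i, H_i F_i K_i` from the source to the fusion centre. -/
def compound (S : SensorNetwork L M K N J) (F : Beamformers N J) : Matrix (Fin M) (Fin K) ℂ :=
  ∑ i, S.chan i * F i * S.obs i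

/-- The covariance of the compound noise at the fusion centre. -/
def noiseCov (S : SensorNetwork L M K N J) (F : Beamformers N J) : Matrix (Fin M) (Fin M) ℂ :=
  ((S.σ₀ ^ 2 : ℝ) : ℂ) • (1 : Matrix (Fin M) (Fin M) ℂ) +
    ∑ i, S.chan i * F i * S.obsCov i * (F i)ᴴ * (S.chan i)ᴴ

/-- The mean square error matrix `Φ` of the beamformers `F` and the receiver `G`. -/
def mseMatrix (S : SensorNetwork L M K N J) (F : Beamformers N J)
    (G : Matrix (Fin M) (Fin K) ℂ) : Matrix (Fin K) (Fin K) ℂ :=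
  Gᴴ * S.compound F * S.srcCov * (S.compound F)ᴴ * G
    - Gᴴ * S.compound F * S.srcCov
    - S.srcCov * (S.compound F)ᴴ * G
    + ∑ i, Gᴴ * S.chan i * F i * S.obsCov i * (F i)ᴴ * (S.chan i)ᴴ * G
    + ((S.σ₀ ^ 2 : ℝ) : ℂ) • (Gᴴ * G)
    + S.srcCov

/-- The total mean square error, as a function of all the variables. (The trace is real, since the
matrix is Hermitian.) -/
def mse (S : SensorNetwork L M K N J)
    (x : Beamformers N J × Matrix (Fin M) (Fin K) ℂ) : ℝ :=
  (S.mseMatrix x.1 x.2).trace.re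

/-- The covariance `K_i Σ_s K_iᴴ + Σ_i` of the observation at sensor `i`. -/
def obsTotalCov (S : SensorNetwork L M K N J) (i : Fin L) : Matrix (Fin (J i)) (Fin (J i)) ℂ :=
  S.obs i * S.srcCov * (S.obs i)ᴴ + S.obsCov i

/-- The beamformers that satisfy all the power constraints. -/
def feasibleBeamformers (S : SensorNetwork L M K N J) : Set (Beamformers N J) :=
  {F | ∀ i, (F i * S.obsTotalCov i * (F i)ᴴ).trace.re ≤ S.power i}

/-- The feasible set of the joint problem: the receiver is unconstrained. -/
def feasibleSet (S : SensorNetwork L M K N J) :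
    Set (Beamformers N J × Matrix (Fin M) (Fin K) ℂ) :=
  {x | x.1 ∈ S.feasibleBeamformers}

/-- The optimal (Wiener) receiver for given beamformers. -/
noncomputable def wiener (S : SensorNetwork L M K N J) (F : Beamformers N J) :
    Matrix (Fin M) (Fin K) ℂ :=
  (S.compound F * S.srcCov * (S.compound F)ᴴ + S.noiseCov F)⁻¹ * (S.compound F * S.srcCov)

/-! ### The problem in one vectorized beamformer `f_i = vec F_i`

With everything else fixed, the mean square error is, up to a constant,
`f_iᴴ (A_ii + C_i) f_i + 2 Re (q_iᴴ f_i) - 2 Re (gᴴ B_i f_i)`, where `g = vec G`, and the power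
constraint is `f_iᴴ E_i f_i ≤ P_i`. -/

/-- `A_ij = (K_j Σ_s K_iᴴ)ᵀ ⊗ (H_iᴴ G Gᴴ H_j)`. -/
def matA (S : SensorNetwork L M K N J) (G : Matrix (Fin M) (Fin K) ℂ) (i j : Fin L) :
    Matrix (Fin (J i) × Fin (N i)) (Fin (J j) × Fin (N j)) ℂ :=
  (S.obs j * S.srcCov * (S.obs i)ᴴ)ᵀ ⊗ₖ ((S.chan i)ᴴ * G * Gᴴ * S.chan j)

/-- `B_i = (K_i Σ_s)ᵀ ⊗ H_i`. -/
def matB (S : SensorNetwork L M K N J) (i : Fin L) :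
    Matrix (Fin K × Fin M) (Fin (J i) × Fin (N i)) ℂ :=
  (S.obs i * S.srcCov)ᵀ ⊗ₖ S.chan i

/-- `C_i = Σ_i^* ⊗ (H_iᴴ G Gᴴ H_i)`, where `^*` is the entrywise conjugate. -/
def matC (S : SensorNetwork L M K N J) (G : Matrix (Fin M) (Fin K) ℂ) (i : Fin L) :
    Matrix (Fin (J i) × Fin (N i)) (Fin (J i) × Fin (N i)) ℂ :=
  (S.obsCov i).map star ⊗ₖ ((S.chan i)ᴴ * G * Gᴴ * S.chan i)

/-- `E_i = (K_i Σ_s K_iᴴ + Σ_i)ᵀ ⊗ I`. -/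
def matE (S : SensorNetwork L M K N J) (i : Fin L) :
    Matrix (Fin (J i) × Fin (N i)) (Fin (J i) × Fin (N i)) ℂ :=
  (S.obsTotalCov i)ᵀ ⊗ₖ (1 : Matrix (Fin (N i)) (Fin (N i)) ℂ)

/-- `q_i = ∑ j ≠ i, A_ij f_j`. -/
def vecQ (S : SensorNetwork L M K N J) (F : Beamformers N J) (G : Matrix (Fin M) (Fin K) ℂ)
    (i : Fin L) : Fin (J i) × Fin (N i) → ℂ :=
  ∑ j ∈ Finset.univ.erase i, S.matA G i j *ᵥ vec (F j)

/-- The linear coefficient `B_iᴴ g - q_i`. -/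
def linCoeff (S : SensorNetwork L M K N J) (F : Beamformers N J) (G : Matrix (Fin M) (Fin K) ℂ)
    (i : Fin L) : Fin (J i) × Fin (N i) → ℂ :=
  (S.matB i)ᴴ *ᵥ vec G - S.vecQ F G i

open scoped MatrixOrder in
/-- `E_i^(-1/2)`, the inverse of the positive semidefinite square root of `E_i`. -/
noncomputable def invSqrtE (S : SensorNetwork L M K N J) (i : Fin L) :
    Matrix (Fin (J i) × Fin (N i)) (Fin (J i) × Fin (N i)) ℂ :=
  (CFC.sqrt (S.matE i))⁻¹

/-- `M_i = E_i^(-1/2) (A_ii + C_i) E_i^(-1/2)`. -/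
noncomputable def matM (S : SensorNetwork L M K N J) (G : Matrix (Fin M) (Fin K) ℂ) (i : Fin L) :
    Matrix (Fin (J i) × Fin (N i)) (Fin (J i) × Fin (N i)) ℂ :=
  S.invSqrtE i * (S.matA G i i + S.matC G i) * S.invSqrtE i

/-- The case in which the Lagrange multiplier of the power constraint is positive, in terms of the
eigenvalues `ev` of `M_i` and the coefficients `p` of `E_i^(-1/2) (B_iᴴ g - q_i)` in an orthonormal
eigenbasis. With the eigenvalues in decreasing order, the indices beyond the rank of `M_i` are those
of the zero eigenvalues. -/
def PositiveMultiplierCase {ι : Type*} [Fintype ι] (ev : ι → ℝ) (p : ι → ℂ) (P : ℝ) : Prop :=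
  (∃ k, ev k = 0 ∧ p k ≠ 0) ∨
    ((∀ k, ev k = 0 → p k = 0) ∧ P < ∑ k with ev k ≠ 0, ‖p k‖ ^ 2 / ev k ^ 2)

/-- The complementary case, in which the multiplier is zero. -/
def ZeroMultiplierCase {ι : Type*} [Fintype ι] (ev : ι → ℝ) (p : ι → ℂ) (P : ℝ) : Prop :=
  (∀ k, ev k = 0 → p k = 0) ∧ ∑ k with ev k ≠ 0, ‖p k‖ ^ 2 / ev k ^ 2 ≤ P

/-- `X` is the (almost) closed-form update of the `i`-th beamformer, given the receiver `G` and the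
other beamformers `F j`, `j ≠ i`. The eigendecomposition `M_i = U diag(ev) Uᴴ` is arbitrary. -/
def IsBeamformerUpdate (S : SensorNetwork L M K N J) (F : Beamformers N J)
    (G : Matrix (Fin M) (Fin K) ℂ) (i : Fin L) (X : Matrix (Fin (N i)) (Fin (J i)) ℂ) : Prop :=
  ∃ U ∈ Matrix.unitaryGroup (Fin (J i) × Fin (N i)) ℂ, ∃ ev : Fin (J i) × Fin (N i) → ℝ,
    S.matM G i = U * diagonal (fun k => (ev k : ℂ)) * Uᴴ ∧
    ((PositiveMultiplierCase ev (Uᴴ *ᵥ (S.invSqrtE i *ᵥ S.linCoeff F G i)) (S.power i) ∧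
        ∃ μ : ℝ, 0 < μ ∧
          ∑ k, ‖(Uᴴ *ᵥ (S.invSqrtE i *ᵥ S.linCoeff F G i)) k‖ ^ 2 / (ev k + μ) ^ 2 = S.power i ∧
          vec X = (S.matA G i i + S.matC G i + (μ : ℂ) • S.matE i)⁻¹ *ᵥ S.linCoeff F G i) ∨
      (ZeroMultiplierCase ev (Uᴴ *ᵥ (S.invSqrtE i *ᵥ S.linCoeff F G i)) (S.power i) ∧
        ∃ Mdag, IsMoorePenroseInverse (S.matM G i) Mdag ∧
          vec X = S.invSqrtE i *ᵥ (Mdag *ᵥ (S.invSqrtE i *ᵥ S.linCoeff F G i))))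

/-- One pass of the inner loop: the beamformers are updated one after the other, in the order
`1, …, L`, each with the latest values of the others; `Y i` are the beamformers before the update of
the `i`-th one. -/
def IsSweep (S : SensorNetwork L M K N J) (G : Matrix (Fin M) (Fin K) ℂ)
    (F F' : Beamformers N J) : Prop :=
  ∃ Y : Fin (L + 1) → Beamformers N J, Y 0 = F ∧ Y (Fin.last L) = F' ∧
    ∀ i : Fin L, ∃ X, S.IsBeamformerUpdate (Y i.castSucc) G i X ∧
      Y i.succ = Function.update (Y i.castSucc) i X

/-- `F'` is a possible outcome of the inner loop that is started from `F` with receiver `G`: either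
the loop is stopped after some finite number (at least one) of passes, whatever the stopping rule,
or it is run indefinitely and `F'` is a limit point of the sequence that it generates. -/
def IsInnerLoop (S : SensorNetwork L M K N J) (G : Matrix (Fin M) (Fin K) ℂ)
    (F F' : Beamformers N J) : Prop :=
  Relation.TransGen (S.IsSweep G) F F' ∨
    ∃ Y : ℕ → Beamformers N J, Y 0 = F ∧ (∀ n, S.IsSweep G (Y n) (Y (n + 1))) ∧
      IsLimitPoint F' Y

/-- The sequence `x j = (F^(j), G^(j))` is generated by the layered block coordinate descent. -/
def IsLayeredBCD (S : SensorNetwork L M K N J)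
    (x : ℕ → Beamformers N J × Matrix (Fin M) (Fin K) ℂ) : Prop :=
  (x 0).1 ∈ S.feasibleBeamformers ∧
    (∀ j, (x j).2 = S.wiener (x j).1) ∧
    ∀ j, S.IsInnerLoop (x j).2 (x j).1 (x (j + 1)).1

end SensorNetwork

/-! For a fixed receiver the MSE is a convex quadratic function of the beamformers, with quadratic
part `beamForm` and half-derivative `slope`. `beamForm` may be degenerate, so block minimizers need
not be unique and successive beamformers need not get close to each other. The argument therefore
measures movement only in the seminorm of `beamForm`.

Each beamformer update satisfies the KKT conditions of its block
(`IsBeamformerUpdate.exists_multiplier`). By convexity this is a variational inequality at the new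
point, and it makes the MSE drop by at least the squared seminorm of the move. The slope changes by
`beamForm` of the displacement, so Cauchy–Schwarz bounds its change by the square root of the drop.
Hence, if a pass lowers the MSE by δ, the block variational inequalities already hold at its
starting point, up to an error of order √δ + δ (`IsSweep.descent`).

Only the first pass of each inner loop matters: the remaining passes and the receiver update do not
increase the MSE, so δ is at most the drop of the whole outer iteration. These drops tend to zero
because the MSE is monotone and nonnegative. In the limit the block inequalities are exact. They add
up to the full inequality because the constraints are separate for each block, and the receiver
direction contributes nothing because the normal equation of the Wiener receiver is a closed
condition. -/

/-! ### The trace form of a positive semidefinite matrix -/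

/-- The real bilinear form `Re tr (A P Bᴴ)`. -/
noncomputable def traceForm {m n : Type*} [Fintype m] [Fintype n] (P : Matrix n n ℂ) :
    LinearMap.BilinForm ℝ (Matrix m n ℂ) :=
  LinearMap.mk₂ ℝ (fun A B => (A * P * Bᴴ).trace.re)
    (fun A A' B => by simp [Matrix.add_mul])
    (fun c A B => by simp)
    (fun A B B' => by simp [Matrix.mul_add])
    (fun c A B => by simp)

section TraceForm

variable {m n : Type*} [Fintype m] [Fintype n]

theorem traceForm_apply (P : Matrix n n ℂ) (A B : Matrix m n ℂ) :
    traceForm P A B = (A * P * Bᴴ).trace.re := rfl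

theorem traceForm_comm {P : Matrix n n ℂ} (hP : P.IsHermitian) (A B : Matrix m n ℂ) :
    traceForm P A B = traceForm P B A := by
  rw [traceForm_apply, traceForm_apply, ← Complex.conj_re]
  change (star _ : ℂ).re = _
  rw [← trace_conjTranspose]
  simp [conjTranspose_mul, hP.eq, Matrix.mul_assoc]

theorem traceForm_self_nonneg {P : Matrix n n ℂ} (hP : P.PosSemidef) (A : Matrix m n ℂ) :
    0 ≤ traceForm P A A :=
  (Complex.le_def.1 (hP.mul_mul_conjTranspose_same A).trace_nonneg).1

theorem traceForm_one_self [DecidableEq n] (A : Matrix m n ℂ) :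
    traceForm 1 A A = ∑ i, ∑ j, ‖A i j‖ ^ 2 := by
  simp [traceForm_apply, trace, mul_apply, Complex.mul_conj, Complex.normSq_eq_norm_sq]
  simp only [← Complex.ofReal_pow, Complex.ofReal_re]

theorem norm_sq_le_traceForm_one [DecidableEq n] (A : Matrix m n ℂ) (i : m) (j : n) :
    ‖A i j‖ ^ 2 ≤ traceForm 1 A A := by
  rw [traceForm_one_self]
  exact (Finset.single_le_sum (f := fun j => ‖A i j‖ ^ 2) (fun _ _ => by positivity)
    (Finset.mem_univ j)).trans (Finset.single_le_sum (f := fun i => ∑ j, ‖A i j‖ ^ 2)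
      (fun _ _ => by positivity) (Finset.mem_univ i))

end TraceForm

theorem isCompact_setOf_norm_le {m n : Type*} (r : ℝ) :
    IsCompact {A : Matrix m n ℂ | ∀ i j, ‖A i j‖ ≤ r} := by
  have h : IsCompact (Set.univ.pi fun _ : m => Set.univ.pi fun _ : n =>
      Metric.closedBall (0 : ℂ) r) :=
    isCompact_univ_pi fun _ => isCompact_univ_pi fun _ => isCompact_closedBall 0 r
  have h' : {A : Matrix m n ℂ | ∀ i j, ‖A i j‖ ≤ r} = Set.univ.pi fun _ : m =>
      Set.univ.pi fun _ : n => Metric.closedBall (0 : ℂ) r := by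
    ext A
    change _ ↔ ∀ i ∈ Set.univ, ∀ j ∈ Set.univ, A i j ∈ Metric.closedBall (0 : ℂ) r
    simp
  exact h' ▸ h

/-! ### The MSE as a quadratic function of the beamformers -/

namespace SensorNetwork

variable {L M K : ℕ} {N J : Fin L → ℕ} (S : SensorNetwork L M K N J)

theorem compound_add (F F' : Beamformers N J) :
    S.compound (F + F') = S.compound F + S.compound F' := by
  simp [compound, Matrix.mul_add, Matrix.add_mul, Finset.sum_add_distrib]

theorem compound_smul (c : ℝ) (F : Beamformers N J) :
    S.compound (c • F) = c • S.compound F := by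
  simp [compound, Finset.smul_sum]

/-- The received signal `Gᴴ T` as a linear function of the beamformers. -/
noncomputable def signalMap (G : Matrix (Fin M) (Fin K) ℂ) :
    Beamformers N J →ₗ[ℝ] Matrix (Fin K) (Fin K) ℂ where
  toFun F := Gᴴ * S.compound F
  map_add' F F' := by rw [compound_add, Matrix.mul_add]
  map_smul' c F := by rw [compound_smul, Matrix.mul_smul, RingHom.id_apply]

/-- The received noise `Gᴴ H_i F_i` as a linear function of the beamformers. -/
noncomputable def noiseMap (G : Matrix (Fin M) (Fin K) ℂ) (i : Fin L) :
    Beamformers N J →ₗ[ℝ] Matrix (Fin K) (Fin (J i)) ℂ where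
  toFun F := Gᴴ * S.chan i * F i
  map_add' F F' := by rw [Pi.add_apply, Matrix.mul_add]
  map_smul' c F := by rw [Pi.smul_apply, Matrix.mul_smul, RingHom.id_apply]

theorem signalMap_apply (G : Matrix (Fin M) (Fin K) ℂ) (F : Beamformers N J) :
    S.signalMap G F = Gᴴ * S.compound F := rfl

theorem noiseMap_apply (G : Matrix (Fin M) (Fin K) ℂ) (i : Fin L) (F : Beamformers N J) :
    S.noiseMap G i F = Gᴴ * S.chan i * F i := rfl

/-- The quadratic part of the mean square error in the beamformers, as a bilinear form. -/
noncomputable def beamForm (G : Matrix (Fin M) (Fin K) ℂ) :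
    LinearMap.BilinForm ℝ (Beamformers N J) :=
  (traceForm S.srcCov).compl₁₂ (S.signalMap G) (S.signalMap G) +
    ∑ i, (traceForm (S.obsCov i)).compl₁₂ (S.noiseMap G i) (S.noiseMap G i)

theorem beamForm_apply (G : Matrix (Fin M) (Fin K) ℂ) (F U : Beamformers N J) :
    S.beamForm G F U = traceForm S.srcCov (S.signalMap G F) (S.signalMap G U) +
      ∑ i, traceForm (S.obsCov i) (S.noiseMap G i F) (S.noiseMap G i U) := by
  simp [beamForm, LinearMap.sum_apply]

/-- Half the derivative of the mean square error in the beamformers. -/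
noncomputable def slope (F : Beamformers N J) (G : Matrix (Fin M) (Fin K) ℂ) :
    Beamformers N J →ₗ[ℝ] ℝ :=
  S.beamForm G F - (traceForm S.srcCov 1).comp (S.signalMap G)

theorem slope_add (F V U : Beamformers N J) (G : Matrix (Fin M) (Fin K) ℂ) :
    S.slope (F + V) G U = S.slope F G U + S.beamForm G V U := by
  simp [slope]; ring

/-- The error splits into signal distortion, forwarded observation noise and receiver noise. With
positive semidefinite covariances each part is nonnegative, which gives the lower bounds on the MSE.
-/
theorem mse_eq (F : Beamformers N J) (G : Matrix (Fin M) (Fin K) ℂ) :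
    S.mse (F, G) = traceForm S.srcCov (S.signalMap G F - 1) (S.signalMap G F - 1) +
      ∑ i, traceForm (S.obsCov i) (S.noiseMap G i F) (S.noiseMap G i F) +
      S.σ₀ ^ 2 * traceForm 1 Gᴴ Gᴴ := by
  have h1 : (1 : Matrix (Fin K) (Fin K) ℂ)ᴴ = 1 := conjTranspose_one
  simp only [traceForm_apply, signalMap_apply, noiseMap_apply, mse, mseMatrix,
    conjTranspose_sub, conjTranspose_mul, conjTranspose_conjTranspose, h1, trace_add, trace_sub,
    trace_sum, trace_smul, Complex.add_re, Complex.sub_re, Complex.re_sum, Matrix.sub_mul,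
    Matrix.mul_sub, Matrix.mul_one, Matrix.one_mul, smul_eq_mul, Complex.re_ofReal_mul,
    Matrix.mul_assoc]
  ring

variable {S}

theorem beamForm_comm (hsrc : S.srcCov.PosSemidef) (hobs : ∀ i, (S.obsCov i).PosSemidef)
    (G : Matrix (Fin M) (Fin K) ℂ) (F U : Beamformers N J) :
    S.beamForm G F U = S.beamForm G U F := by
  rw [beamForm_apply, beamForm_apply, traceForm_comm hsrc.1,
    Finset.sum_congr rfl fun i _ => traceForm_comm (hobs i).1 (S.noiseMap G i F) _]

theorem beamForm_self_nonneg (hsrc : S.srcCov.PosSemidef) (hobs : ∀ i, (S.obsCov i).PosSemidef)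
    (G : Matrix (Fin M) (Fin K) ℂ) (F : Beamformers N J) : 0 ≤ S.beamForm G F F := by
  rw [beamForm_apply]
  exact add_nonneg (traceForm_self_nonneg hsrc _)
    (Finset.sum_nonneg fun i _ => traceForm_self_nonneg (hobs i) _)

/-- Cauchy–Schwarz holds for a semidefinite form; no definiteness is available here. -/
theorem beamForm_sq_le (hsrc : S.srcCov.PosSemidef) (hobs : ∀ i, (S.obsCov i).PosSemidef)
    (G : Matrix (Fin M) (Fin K) ℂ) (F U : Beamformers N J) :
    S.beamForm G F U ^ 2 ≤ S.beamForm G F F * S.beamForm G U U :=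
  (S.beamForm G).apply_sq_le_of_symm (beamForm_self_nonneg hsrc hobs G)
    ⟨fun F U => beamForm_comm hsrc hobs G F U⟩ F U

theorem mse_add_beam (hsrc : S.srcCov.PosSemidef) (hobs : ∀ i, (S.obsCov i).PosSemidef)
    (F U : Beamformers N J) (G : Matrix (Fin M) (Fin K) ℂ) :
    S.mse (F + U, G) = S.mse (F, G) + 2 * S.slope F G U + S.beamForm G U U := by
  have h1 := beamForm_comm hsrc hobs G U F
  have h2 := traceForm_comm hsrc.1 (S.signalMap G U) 1
  have key : ∀ F, S.mse (F, G) = S.beamForm G F F - 2 * traceForm S.srcCov 1 (S.signalMap G F) +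
      traceForm S.srcCov (1 : Matrix (Fin K) (Fin K) ℂ) 1 + S.σ₀ ^ 2 * traceForm 1 Gᴴ Gᴴ := by
    intro F
    have h2 := traceForm_comm hsrc.1 (S.signalMap G F) 1
    rw [mse_eq S F G, beamForm_apply]
    simp only [map_sub, LinearMap.sub_apply, h2]
    ring
  rw [key, key, slope]
  simp only [map_add, LinearMap.add_apply, LinearMap.sub_apply, LinearMap.comp_apply, h1]
  ring

theorem mse_nonneg (hsrc : S.srcCov.PosSemidef) (hobs : ∀ i, (S.obsCov i).PosSemidef)
    (F : Beamformers N J) (G : Matrix (Fin M) (Fin K) ℂ) : 0 ≤ S.mse (F, G) := by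
  rw [mse_eq S F G]
  exact add_nonneg (add_nonneg (traceForm_self_nonneg hsrc _)
    (Finset.sum_nonneg fun i _ => traceForm_self_nonneg (hobs i) _))
    (mul_nonneg (sq_nonneg _) (traceForm_self_nonneg PosSemidef.one _))

/-- Since σ₀ > 0 in the application, a bound on the MSE bounds the receiver. -/
theorem traceForm_receiver_le_mse (hsrc : S.srcCov.PosSemidef)
    (hobs : ∀ i, (S.obsCov i).PosSemidef) (F : Beamformers N J) (G : Matrix (Fin M) (Fin K) ℂ) :
    S.σ₀ ^ 2 * traceForm 1 Gᴴ Gᴴ ≤ S.mse (F, G) := by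
  rw [mse_eq S F G]
  exact le_add_of_nonneg_left (add_nonneg (traceForm_self_nonneg hsrc _)
    (Finset.sum_nonneg fun i _ => traceForm_self_nonneg (hobs i) _))

/-! ### The receiver -/

/-- The normal equation removes the term linear in `t`. It is assumed in the form without an
inverse, which passes to limits. The value `t = 1` gives optimality of the Wiener receiver, and the
behaviour at `t = 0` gives the vanishing derivative. -/
theorem exists_mse_add_receiver (hsrc : S.srcCov.PosSemidef)
    (hobs : ∀ i, (S.obsCov i).PosSemidef) {F : Beamformers N J} {G : Matrix (Fin M) (Fin K) ℂ}
    (hG : (S.compound F * S.srcCov * (S.compound F)ᴴ + S.noiseCov F) * G =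
      S.compound F * S.srcCov) (V : Matrix (Fin M) (Fin K) ℂ) :
    ∃ q : ℝ, 0 ≤ q ∧ ∀ t : ℝ, S.mse (F, G + t • V) = S.mse (F, G) + t ^ 2 * q := by
  refine ⟨traceForm S.srcCov (S.signalMap V F) (S.signalMap V F) +
      ∑ i, traceForm (S.obsCov i) (S.noiseMap V i F) (S.noiseMap V i F) +
      S.σ₀ ^ 2 * traceForm 1 Vᴴ Vᴴ, ?_, fun t => ?_⟩
  · exact add_nonneg (add_nonneg (traceForm_self_nonneg hsrc _)
      (Finset.sum_nonneg fun i _ => traceForm_self_nonneg (hobs i) _))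
      (mul_nonneg (sq_nonneg _) (traceForm_self_nonneg PosSemidef.one _))
  have hs : S.signalMap (G + t • V) F - 1 = (S.signalMap G F - 1) + t • S.signalMap V F := by
    simp [signalMap_apply, Matrix.add_mul]; abel
  have hn : ∀ i, S.noiseMap (G + t • V) i F = S.noiseMap G i F + t • S.noiseMap V i F := by
    intro i; simp [noiseMap_apply, Matrix.add_mul]
  have hg : (G + t • V)ᴴ = Gᴴ + t • Vᴴ := by simp
  -- Half the linear coefficient in direction `V` is the real trace of `Vᴴ` times the residual of
  -- the normal equation.
  have cross : traceForm S.srcCov (S.signalMap V F) (S.signalMap G F - 1) +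
      ∑ i, traceForm (S.obsCov i) (S.noiseMap V i F) (S.noiseMap G i F) +
      S.σ₀ ^ 2 * traceForm 1 Vᴴ Gᴴ = 0 := by
    have h : (Vᴴ * ((S.compound F * S.srcCov * (S.compound F)ᴴ + S.noiseCov F) * G -
      S.compound F * S.srcCov)).trace.re = 0 := by rw [hG]; simp
    have h1 : (1 : Matrix (Fin K) (Fin K) ℂ)ᴴ = 1 := conjTranspose_one
    rw [← h]
    simp only [noiseCov, traceForm_apply, signalMap_apply, noiseMap_apply,
      conjTranspose_sub, conjTranspose_mul, conjTranspose_conjTranspose, h1, trace_add, trace_sub,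
      trace_sum, trace_smul, Complex.add_re, Complex.sub_re, Complex.re_sum,
      Matrix.mul_sub, Matrix.mul_one, Matrix.one_mul, smul_eq_mul, Complex.re_ofReal_mul,
      Matrix.mul_assoc, Matrix.add_mul, Matrix.mul_add, Matrix.sum_mul, Matrix.mul_sum,
      Matrix.smul_mul, Matrix.mul_smul]
    ring
  have cross' : traceForm S.srcCov (S.signalMap G F - 1) (S.signalMap V F) +
      ∑ i, traceForm (S.obsCov i) (S.noiseMap G i F) (S.noiseMap V i F) +
      S.σ₀ ^ 2 * traceForm 1 Gᴴ Vᴴ = 0 := by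
    rw [← cross, traceForm_comm hsrc.1, traceForm_comm isHermitian_one Gᴴ,
      Finset.sum_congr rfl fun i _ => traceForm_comm (hobs i).1 (S.noiseMap G i F) _]
  rw [mse_eq S _ _, mse_eq S _ _, hs, hg]
  simp only [hn, map_add, map_smul, LinearMap.add_apply, LinearMap.smul_apply, smul_eq_mul,
    Finset.sum_add_distrib, ← Finset.mul_sum]
  linear_combination t * cross + t * cross'

theorem receiverCov_posDef (hsrc : S.srcCov.PosSemidef)
    (hobs : ∀ i, (S.obsCov i).PosSemidef) (hσ : 0 < S.σ₀) (F : Beamformers N J) :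
    (S.compound F * S.srcCov * (S.compound F)ᴴ + S.noiseCov F).PosDef := by
  refine PosDef.posSemidef_add (hsrc.mul_mul_conjTranspose_same _) ?_
  refine PosDef.add_posSemidef (PosDef.one.smul ?_) (posSemidef_sum _ fun i _ => ?_)
  · exact_mod_cast pow_pos hσ 2
  · simpa [Matrix.mul_assoc] using (hobs i).mul_mul_conjTranspose_same (S.chan i * F i)

theorem receiverCov_mul_wiener (hsrc : S.srcCov.PosSemidef)
    (hobs : ∀ i, (S.obsCov i).PosSemidef) (hσ : 0 < S.σ₀) (F : Beamformers N J) :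
    (S.compound F * S.srcCov * (S.compound F)ᴴ + S.noiseCov F) * S.wiener F =
      S.compound F * S.srcCov := by
  rw [wiener, Matrix.mul_nonsing_inv_cancel_left]
  exact (isUnit_iff_isUnit_det _).1 (receiverCov_posDef hsrc hobs hσ F).isUnit

theorem mse_wiener_le (hsrc : S.srcCov.PosSemidef)
    (hobs : ∀ i, (S.obsCov i).PosSemidef) (hσ : 0 < S.σ₀) (F : Beamformers N J)
    (G : Matrix (Fin M) (Fin K) ℂ) : S.mse (F, S.wiener F) ≤ S.mse (F, G) := by
  obtain ⟨q, hq, h⟩ := exists_mse_add_receiver hsrc hobs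
    (receiverCov_mul_wiener hsrc hobs hσ F) (G - S.wiener F)
  have := h 1
  rw [one_smul, add_sub_cancel] at this
  linarith

end SensorNetwork

/-! ### Spectral form of the multiplier equations -/

section Spectral

variable {ι : Type*} [Fintype ι]

theorem star_dotProduct_self_re (v : ι → ℂ) : (star v ⬝ᵥ v).re = ∑ k, ‖v k‖ ^ 2 := by
  simp only [dotProduct, Complex.re_sum]
  refine Finset.sum_congr rfl fun k _ => ?_
  rw [Pi.star_apply, ← Complex.normSq_eq_norm_sq, mul_comm]
  exact congrArg Complex.re (Complex.mul_conj (v k))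

variable [DecidableEq ι]

theorem star_dotProduct_self_unitary {U : Matrix ι ι ℂ} (hU : U ∈ unitaryGroup ι ℂ) (v : ι → ℂ) :
    star (Uᴴ *ᵥ v) ⬝ᵥ (Uᴴ *ᵥ v) = star v ⬝ᵥ v := by
  rw [star_mulVec, conjTranspose_conjTranspose, dotProduct_mulVec, vecMul_vecMul,
    show U * Uᴴ = 1 from mem_unitaryGroup_iff.1 hU, vecMul_one]

theorem eigenvalue_nonneg {A U : Matrix ι ι ℂ} (hA : A.PosSemidef) (hU : U ∈ unitaryGroup ι ℂ)
    {ev : ι → ℝ} (h : A = U * diagonal (fun k => (ev k : ℂ)) * Uᴴ) (k : ι) : 0 ≤ ev k := by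
  have hU' : Uᴴ * U = 1 := mem_unitaryGroup_iff'.1 hU
  have h1 : Uᴴ * A * U = diagonal fun k => (ev k : ℂ) := by
    rw [h]
    simp only [Matrix.mul_assoc, hU', Matrix.mul_one]
    rw [← Matrix.mul_assoc, hU', Matrix.one_mul]
  have h2 := hA.conjTranspose_mul_mul_same U
  rw [h1, posSemidef_diagonal_iff] at h2
  exact_mod_cast h2 k

/-- If `(A + μ R²) x = c` with `μ > 0`, the energy of `R x` is determined by the eigenvalues. -/
theorem energy_of_pos_multiplier {A R U : Matrix ι ι ℂ} (hR : IsUnit R) {ev : ι → ℝ}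
    (hU : U ∈ unitaryGroup ι ℂ) (hM : R⁻¹ * A * R⁻¹ = U * diagonal (fun k => (ev k : ℂ)) * Uᴴ)
    (hev : ∀ k, 0 ≤ ev k) {μ : ℝ} (hμ : 0 < μ) {x c : ι → ℂ}
    (hx : (A + (μ : ℂ) • (R * R)) *ᵥ x = c) :
    (star (R *ᵥ x) ⬝ᵥ (R *ᵥ x)).re =
      ∑ k, ‖(Uᴴ *ᵥ (R⁻¹ *ᵥ c)) k‖ ^ 2 / (ev k + μ) ^ 2 := by
  have hU' : Uᴴ * U = 1 := mem_unitaryGroup_iff'.1 hU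
  have hR' : R⁻¹ * R = 1 := nonsing_inv_mul _ ((isUnit_iff_isUnit_det _).1 hR)
  -- In the eigenbasis the equation becomes diagonal in the coordinates of `R x`.
  have key : Uᴴ *ᵥ (R⁻¹ *ᵥ c) =
      (diagonal (fun k => (ev k : ℂ)) + (μ : ℂ) • 1) *ᵥ (Uᴴ *ᵥ (R *ᵥ x)) := by
    rw [← hx]
    simp only [mulVec_mulVec]
    congr 1
    have e1 : diagonal (fun k => (ev k : ℂ)) * Uᴴ = Uᴴ * (R⁻¹ * A * R⁻¹) := by
      rw [hM, Matrix.mul_assoc U, ← Matrix.mul_assoc, hU', Matrix.one_mul]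
    have e2 : R⁻¹ * A * R⁻¹ * R = R⁻¹ * A := by rw [Matrix.mul_assoc, hR', Matrix.mul_one]
    have e3 : R⁻¹ * (R * R) = R := by rw [← Matrix.mul_assoc, hR', Matrix.one_mul]
    rw [← Matrix.mul_assoc _ Uᴴ R, Matrix.add_mul, Matrix.add_mul, e1, Matrix.mul_assoc Uᴴ, e2,
      Matrix.mul_add, Matrix.mul_add, Matrix.mul_smul, e3]
    simp
  rw [← star_dotProduct_self_unitary hU, star_dotProduct_self_re]
  refine Finset.sum_congr rfl fun k _ => ?_
  have hk : 0 < ev k + μ := add_pos_of_nonneg_of_pos (hev k) hμ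
  have : (Uᴴ *ᵥ (R⁻¹ *ᵥ c)) k = ((ev k + μ : ℝ) : ℂ) * (Uᴴ *ᵥ (R *ᵥ x)) k := by
    rw [key, add_mulVec, Pi.add_apply, mulVec_diagonal, smul_mulVec, one_mulVec]
    simp [add_mul]
  rw [this, norm_mul, Complex.norm_real, Real.norm_of_nonneg hk.le, mul_pow]
  field_simp

/-- The Moore-Penrose solution solves the equation, when it is solvable, and its energy is
determined by the eigenvalues. -/
theorem moorePenrose_mulVec {A B U : Matrix ι ι ℂ} {ev : ι → ℝ}
    (hU : U ∈ unitaryGroup ι ℂ) (hA : A = U * diagonal (fun k => (ev k : ℂ)) * Uᴴ)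
    (hB : IsMoorePenroseInverse A B) {b : ι → ℂ} (hb : ∀ k, ev k = 0 → (Uᴴ *ᵥ b) k = 0) :
    A *ᵥ (B *ᵥ b) = b ∧ (star (B *ᵥ b) ⬝ᵥ (B *ᵥ b)).re =
      ∑ k with ev k ≠ 0, ‖(Uᴴ *ᵥ b) k‖ ^ 2 / ev k ^ 2 := by
  have hU' : Uᴴ * U = 1 := mem_unitaryGroup_iff'.1 hU
  have hU'' : U * Uᴴ = 1 := mem_unitaryGroup_iff.1 hU
  have hUA : Uᴴ * A = diagonal (fun k => (ev k : ℂ)) * Uᴴ := by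
    rw [hA, Matrix.mul_assoc U, ← Matrix.mul_assoc, hU', Matrix.one_mul]
  have hAH : Aᴴ = A := by
    rw [hA]
    simp only [conjTranspose_mul, conjTranspose_conjTranspose, diagonal_conjTranspose,
      Matrix.mul_assoc]
    congr 3
    ext k
    simp
  obtain ⟨h1, h2, -, h4⟩ := hB
  have hAb : A *ᵥ (B *ᵥ b) = b := by
    -- `b` lies in the range of `A`: divide its coordinates by the eigenvalues. Where `ev k = 0` the
    -- quotient is `0` by convention, and the coordinate of `b` vanishes as well.
    have hw : b = A *ᵥ (U *ᵥ fun k => (Uᴴ *ᵥ b) k / ev k) := by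
      have : Uᴴ *ᵥ b = diagonal (fun k => (ev k : ℂ)) *ᵥ fun k => (Uᴴ *ᵥ b) k / ev k := by
        ext k
        rw [mulVec_diagonal]
        by_cases hk : ev k = 0
        · rw [hb k hk, hk]; simp
        · have : (ev k : ℂ) ≠ 0 := by exact_mod_cast hk
          field_simp
      calc b = U *ᵥ (Uᴴ *ᵥ b) := by rw [mulVec_mulVec, hU'', one_mulVec]
        _ = _ := by
          conv_lhs => rw [this]
          rw [hA]
          simp only [mulVec_mulVec, Matrix.mul_assoc]
          rw [hU', Matrix.mul_one]
    rw [hw]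
    generalize (U *ᵥ fun k => (Uᴴ *ᵥ b) k / (ev k : ℂ)) = w
    rw [mulVec_mulVec, mulVec_mulVec, h1]
  refine ⟨hAb, ?_⟩
  rw [← star_dotProduct_self_unitary hU, star_dotProduct_self_re, Finset.sum_filter]
  refine Finset.sum_congr rfl fun k _ => ?_
  split_ifs with hk
  · have : (Uᴴ *ᵥ b) k = (ev k : ℂ) * (Uᴴ *ᵥ (B *ᵥ b)) k := by
      conv_lhs => rw [← hAb]
      rw [mulVec_mulVec, hUA, ← mulVec_mulVec, mulVec_diagonal]
    have hk' : ev k ^ 2 ≠ 0 := pow_ne_zero _ hk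
    rw [this, norm_mul, Complex.norm_real, mul_pow, Real.norm_eq_abs, sq_abs]
    field_simp
  · rw [not_not] at hk
    -- `B = B A B = (B A)ᴴ B = A Bᴴ B`, so `B b` lies in the range of the Hermitian `A` and has no
    -- component along zero eigenvalues.
    have hz : B *ᵥ b = A *ᵥ (Bᴴ *ᵥ (B *ᵥ b)) := by
      have : B = A * Bᴴ * B := by
        conv_lhs => rw [← h2, ← h4, conjTranspose_mul, hAH]
      conv_lhs => rw [this]
      simp only [mulVec_mulVec, Matrix.mul_assoc]
    rw [hz, mulVec_mulVec, hUA, ← mulVec_mulVec, mulVec_diagonal, hk]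
    simp

end Spectral

/-! ### Optimality conditions for a single beamformer update -/

namespace SensorNetwork

variable {L M K : ℕ} {N J : Fin L → ℕ} (S : SensorNetwork L M K N J)

/-- Half the gradient of the mean square error in the `i`-th beamformer. -/
noncomputable def gradBeam (F : Beamformers N J) (G : Matrix (Fin M) (Fin K) ℂ) (i : Fin L) :
    Matrix (Fin (N i)) (Fin (J i)) ℂ :=
  (S.chan i)ᴴ * G * (Gᴴ * S.compound F * S.srcCov - S.srcCov) * (S.obs i)ᴴ +
    (S.chan i)ᴴ * G * Gᴴ * S.chan i * F i * S.obsCov i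

variable {S}

theorem compound_single (i : Fin L) (U : Matrix (Fin (N i)) (Fin (J i)) ℂ) :
    S.compound (Pi.single i U) = S.chan i * U * S.obs i := by
  rw [compound, Finset.sum_eq_single i]
  · simp
  · intro j _ hj
    simp [Pi.single_eq_of_ne hj]
  · simp

/-- Cyclicity of the trace links the two forms of the derivative: `slope` suits Cauchy–Schwarz,
while `gradBeam` is visibly continuous and can be compared with the update equations. -/
theorem slope_single (F : Beamformers N J) (G : Matrix (Fin M) (Fin K) ℂ) (i : Fin L)
    (U : Matrix (Fin (N i)) (Fin (J i)) ℂ) :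
    S.slope F G (Pi.single i U) = (Uᴴ * S.gradBeam F G i).trace.re := by
  have hn : ∑ j, traceForm (S.obsCov j) (S.noiseMap G j F) (S.noiseMap G j (Pi.single i U)) =
      traceForm (S.obsCov i) (Gᴴ * S.chan i * F i) (Gᴴ * S.chan i * U) := by
    rw [Finset.sum_eq_single i]
    · simp [noiseMap_apply]
    · intro j _ hj
      simp [noiseMap_apply, Pi.single_eq_of_ne hj]
    · simp
  rw [slope, LinearMap.sub_apply, beamForm_apply, LinearMap.comp_apply, hn]
  simp only [signalMap_apply, compound_single, traceForm_apply, gradBeam, conjTranspose_mul,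
    conjTranspose_conjTranspose, Matrix.mul_add, trace_add, Complex.add_re, Matrix.mul_sub,
    Matrix.sub_mul, trace_sub, Complex.sub_re, Matrix.one_mul]
  have e1 : ∀ (X : Matrix (Fin K) (Fin K) ℂ) (Y : Matrix (Fin M) (Fin K) ℂ),
      (X * ((S.obs i)ᴴ * (Uᴴ * (S.chan i)ᴴ) * Y)).trace =
        (Uᴴ * ((S.chan i)ᴴ * Y * X * (S.obs i)ᴴ)).trace := by
    intro X Y
    calc _ = ((X * (S.obs i)ᴴ) * (Uᴴ * (S.chan i)ᴴ * Y)).trace := by simp only [Matrix.mul_assoc]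
      _ = _ := by rw [trace_mul_comm]; simp only [Matrix.mul_assoc]
  have e2 : ∀ (X : Matrix (Fin K) (Fin (J i)) ℂ) (Y : Matrix (Fin M) (Fin K) ℂ),
      (X * (Uᴴ * ((S.chan i)ᴴ * Y))).trace = (Uᴴ * ((S.chan i)ᴴ * Y * X)).trace := by
    intro X Y
    rw [trace_mul_comm]; simp only [Matrix.mul_assoc]
  rw [e1, e1, e2]
  simp only [Matrix.mul_assoc]
  ring

theorem obsTotalCov_posDef (hsrc : S.srcCov.PosSemidef) (hobs : ∀ i, (S.obsCov i).PosSemidef)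
    (hpos : ∀ i, (S.obs i * S.srcCov * (S.obs i)ᴴ).PosDef ∨ (S.obsCov i).PosDef) (i : Fin L) :
    (S.obsTotalCov i).PosDef := by
  rcases hpos i with h | h
  · exact h.add_posSemidef (hobs i)
  · exact h.posSemidef_add (hsrc.mul_mul_conjTranspose_same _)

theorem matE_posDef {i : Fin L} (h : (S.obsTotalCov i).PosDef) : (S.matE i).PosDef :=
  h.transpose.kronecker PosDef.one

theorem matA_add_matC_posSemidef (hsrc : S.srcCov.PosSemidef)
    (hobs : ∀ i, (S.obsCov i).PosSemidef) (G : Matrix (Fin M) (Fin K) ℂ) (i : Fin L) :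
    (S.matA G i i + S.matC G i).PosSemidef := by
  have hg : ((S.chan i)ᴴ * G * Gᴴ * S.chan i).PosSemidef := by
    simpa [Matrix.mul_assoc] using posSemidef_self_mul_conjTranspose ((S.chan i)ᴴ * G)
  refine PosSemidef.add ?_ ?_
  · exact (hsrc.mul_mul_conjTranspose_same _).transpose.kronecker hg
  · have : (S.obsCov i).map star = (S.obsCov i)ᵀ := by
      conv_rhs => rw [← (hobs i).1.eq]
      rfl
    rw [matC, this]
    exact (hobs i).transpose.kronecker hg

/-- Follows from `vec (A X B) = (Bᵀ ⊗ A) vec X`. It turns the linear system solved by the update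
into a statement about the gradient at the updated point. -/
theorem vec_gradBeam (hsrc : S.srcCov.PosSemidef) (hobs : ∀ i, (S.obsCov i).PosSemidef)
    (F : Beamformers N J) (G : Matrix (Fin M) (Fin K) ℂ) (i : Fin L)
    (X : Matrix (Fin (N i)) (Fin (J i)) ℂ) :
    vec (S.gradBeam (Function.update F i X) G i) =
      (S.matA G i i + S.matC G i) *ᵥ vec X - S.linCoeff F G i := by
  have hC : S.matC G i *ᵥ vec X =
      vec ((S.chan i)ᴴ * G * Gᴴ * S.chan i * X * S.obsCov i) := by
    rw [matC, kronecker_mulVec_vec]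
    congr 2
    ext a b
    simpa using congrFun (congrFun (hobs i).1.eq a) b
  have hB : (S.matB i)ᴴ *ᵥ vec G = vec ((S.chan i)ᴴ * G * (S.srcCov * (S.obs i)ᴴ)) := by
    rw [matB, conjTranspose_kronecker, kronecker_mulVec_vec]
    congr 2
    rw [show (S.obs i * S.srcCov)ᵀᴴᵀ = (S.obs i * S.srcCov)ᴴ from rfl, conjTranspose_mul,
      hsrc.1.eq]
  have hA : ∀ (j : Fin L) (Y : Matrix (Fin (N j)) (Fin (J j)) ℂ), S.matA G i j *ᵥ vec Y =
      vec ((S.chan i)ᴴ * G * Gᴴ * (S.chan j * Y * S.obs j) * S.srcCov * (S.obs i)ᴴ) := by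
    intro j Y
    rw [matA, kronecker_mulVec_vec, transpose_transpose]
    simp only [Matrix.mul_assoc]
  have hT : S.matA G i i *ᵥ vec X + S.vecQ F G i = vec ((S.chan i)ᴴ * G * Gᴴ *
      S.compound (Function.update F i X) * S.srcCov * (S.obs i)ᴴ) := by
    have hc : S.compound (Function.update F i X) = S.chan i * X * S.obs i +
        ∑ j ∈ Finset.univ.erase i, S.chan j * F j * S.obs j := by
      rw [compound, ← Finset.add_sum_erase _ _ (Finset.mem_univ i), Function.update_self]
      rw [Finset.sum_congr rfl fun j hj => by
        rw [Function.update_of_ne (Finset.ne_of_mem_erase hj)]]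
    rw [hc, vecQ]
    simp only [hA, Matrix.mul_add, Matrix.add_mul, Matrix.mul_sum, Matrix.sum_mul, vec_add,
      vec_sum]
  rw [linCoeff, add_mulVec, hC, hB]
  have : ∀ a b c d : Fin (J i) × Fin (N i) → ℂ, a + b - (c - d) = (a + d) - c + b := by
    intros; abel
  rw [this, hT, ← vec_sub, ← vec_add, gradBeam, Function.update_self]
  simp only [Matrix.mul_sub, Matrix.sub_mul, Matrix.mul_assoc]

theorem star_vec_dotProduct_matE_mulVec (i : Fin L) (X Y : Matrix (Fin (N i)) (Fin (J i)) ℂ) :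
    (star (vec X) ⬝ᵥ S.matE i *ᵥ vec Y).re = traceForm (S.obsTotalCov i) Y X := by
  rw [matE, kronecker_mulVec_vec, star_vec_dotProduct_vec, trace_mul_comm, transpose_transpose,
    Matrix.one_mul, traceForm_apply]

open scoped MatrixOrder in
/-- The Karush-Kuhn-Tucker conditions for the updated beamformer. -/
theorem IsBeamformerUpdate.exists_multiplier (hsrc : S.srcCov.PosSemidef)
    (hobs : ∀ i, (S.obsCov i).PosSemidef) {F : Beamformers N J} {G : Matrix (Fin M) (Fin K) ℂ}
    {i : Fin L} (hW : (S.obsTotalCov i).PosDef) {X : Matrix (Fin (N i)) (Fin (J i)) ℂ}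
    (h : S.IsBeamformerUpdate F G i X) :
    ∃ μ : ℝ, 0 ≤ μ ∧
      S.gradBeam (Function.update F i X) G i + (μ : ℂ) • (X * S.obsTotalCov i) = 0 ∧
      traceForm (S.obsTotalCov i) X X ≤ S.power i ∧
      (μ = 0 ∨ traceForm (S.obsTotalCov i) X X = S.power i) := by
  obtain ⟨U, hU, ev, hM, h⟩ := h
  have hE := matE_posDef hW
  have hQ := matA_add_matC_posSemidef hsrc hobs G i
  have hRR : CFC.sqrt (S.matE i) * CFC.sqrt (S.matE i) = S.matE i :=
    CFC.sqrt_mul_sqrt_self _ hE.posSemidef.nonneg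
  have hRH : (CFC.sqrt (S.matE i))ᴴ = CFC.sqrt (S.matE i) :=
    (CFC.sqrt_nonneg (S.matE i)).posSemidef.1.eq
  have hR : IsUnit (CFC.sqrt (S.matE i)) := by
    have := hE.isUnit
    rw [← hRR] at this
    exact isUnit_of_mul_isUnit_left this
  have hEX : S.matE i *ᵥ vec X = vec (X * S.obsTotalCov i) := by
    rw [matE, kronecker_mulVec_vec, transpose_transpose, Matrix.one_mul]
  have grad : ∀ μ : ℝ, (S.matA G i i + S.matC G i + (μ : ℂ) • S.matE i) *ᵥ vec X =
      S.linCoeff F G i →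
      S.gradBeam (Function.update F i X) G i + (μ : ℂ) • (X * S.obsTotalCov i) = 0 := by
    intro μ hμ
    rw [add_mulVec _ _ (vec X), smul_mulVec] at hμ
    rw [← vec_eq_zero_iff, vec_add, vec_gradBeam hsrc hobs, vec_smul, ← hEX, ← hμ]
    abel
  have energy : traceForm (S.obsTotalCov i) X X =
      (star (CFC.sqrt (S.matE i) *ᵥ vec X) ⬝ᵥ (CFC.sqrt (S.matE i) *ᵥ vec X)).re := by
    rw [← star_vec_dotProduct_matE_mulVec, star_mulVec, hRH, ← dotProduct_mulVec, mulVec_mulVec,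
      hRR]
  have hRinv : (CFC.sqrt (S.matE i))⁻¹ * CFC.sqrt (S.matE i) = 1 :=
    nonsing_inv_mul _ ((isUnit_iff_isUnit_det _).1 hR)
  have hRinv' : CFC.sqrt (S.matE i) * (CFC.sqrt (S.matE i))⁻¹ = 1 :=
    mul_nonsing_inv _ ((isUnit_iff_isUnit_det _).1 hR)
  have hMpsd : (S.matM G i).PosSemidef := by
    have := hQ.mul_mul_conjTranspose_same (CFC.sqrt (S.matE i))⁻¹
    rwa [conjTranspose_nonsing_inv, hRH] at this
  have hev := eigenvalue_nonneg hMpsd hU hM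
  rw [matM] at hM
  rcases h with ⟨-, μ, hμ, hsum, hX⟩ | ⟨⟨h0, hsum⟩, B, hB, hX⟩
  · have hlin : (S.matA G i i + S.matC G i + (μ : ℂ) • S.matE i) *ᵥ vec X =
        S.linCoeff F G i := by
      have : (S.matA G i i + S.matC G i + (μ : ℂ) • S.matE i).PosDef :=
        PosDef.posSemidef_add hQ (hE.smul (by exact_mod_cast hμ))
      rw [hX, mulVec_mulVec, mul_nonsing_inv _ ((isUnit_iff_isUnit_det _).1 this.isUnit),
        one_mulVec]
    have hen : traceForm (S.obsTotalCov i) X X = S.power i := by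
      rw [energy, ← hsum]
      rw [← hRR] at hlin
      exact energy_of_pos_multiplier hR hU hM hev hμ hlin
    exact ⟨μ, hμ.le, grad μ hlin, hen.le, Or.inr hen⟩
  · obtain ⟨h1, h2⟩ := moorePenrose_mulVec hU (by rw [matM]; exact hM) hB h0
    have hRX : CFC.sqrt (S.matE i) *ᵥ vec X =
        B *ᵥ (S.invSqrtE i *ᵥ S.linCoeff F G i) := by
      rw [hX, invSqrtE, mulVec_mulVec, hRinv', one_mulVec]
    refine ⟨0, le_rfl, grad 0 ?_, ?_, Or.inl rfl⟩
    · rw [Complex.ofReal_zero, zero_smul, add_zero]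
      -- With `R` the square root of `E_i`, multiplying `M_i (R vec X) = R⁻¹ c_i` by `R` gives
      -- `(A_ii + C_i) vec X = c_i`.
      have := congrArg (CFC.sqrt (S.matE i) *ᵥ ·) h1
      simp only [← hRX] at this
      simp only [matM, invSqrtE, mulVec_mulVec, ← Matrix.mul_assoc, hRinv', Matrix.one_mul] at this
      rwa [Matrix.mul_assoc _ _ (CFC.sqrt (S.matE i)), hRinv, Matrix.mul_one, one_mulVec] at this
    · rw [energy, hRX, h2]
      exact hsum

/-- The updated beamformer satisfies the power constraint and the variational inequality. -/
theorem IsBeamformerUpdate.slope_nonneg (hsrc : S.srcCov.PosSemidef)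
    (hobs : ∀ i, (S.obsCov i).PosSemidef) {F : Beamformers N J} {G : Matrix (Fin M) (Fin K) ℂ}
    {i : Fin L} (hW : (S.obsTotalCov i).PosDef) {X : Matrix (Fin (N i)) (Fin (J i)) ℂ}
    (h : S.IsBeamformerUpdate F G i X) :
    traceForm (S.obsTotalCov i) X X ≤ S.power i ∧
      ∀ Z, traceForm (S.obsTotalCov i) Z Z ≤ S.power i →
        0 ≤ S.slope (Function.update F i X) G (Pi.single i (Z - X)) := by
  obtain ⟨μ, hμ, hgrad, hX, hcompl⟩ := h.exists_multiplier hsrc hobs hW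
  refine ⟨hX, fun Z hZ => ?_⟩
  have : S.slope (Function.update F i X) G (Pi.single i (Z - X)) =
      -(μ * traceForm (S.obsTotalCov i) X (Z - X)) := by
    rw [slope_single, eq_neg_of_add_eq_zero_left hgrad, traceForm_apply, Matrix.mul_neg,
      trace_neg, Complex.neg_re, Matrix.mul_smul, trace_smul, smul_eq_mul, Complex.re_ofReal_mul,
      trace_mul_comm]
  rw [this, map_sub]
  -- If the constraint is active, then ⟨X, Z⟩ ≤ (⟨X, X⟩ + ⟨Z, Z⟩) / 2 ≤ P = ⟨X, X⟩, by nonnegativity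
  -- of the form at `X - Z`.
  rcases hcompl with h0 | hP
  · simp [h0]
  · have h1 := traceForm_self_nonneg hW.posSemidef (X - Z)
    have h2 := traceForm_comm hW.1 X Z
    simp only [map_sub, LinearMap.sub_apply] at h1
    nlinarith

variable (S)

/-! ### Continuity and differentiability -/

theorem continuous_compound : Continuous S.compound := by
  unfold compound
  fun_prop

theorem continuous_mse : Continuous S.mse := by
  have := S.continuous_compound
  unfold mse mseMatrix
  fun_prop

theorem continuous_gradBeam (i : Fin L) :
    Continuous fun x : Beamformers N J × Matrix (Fin M) (Fin K) ℂ => S.gradBeam x.1 x.2 i := by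
  have := S.continuous_compound
  unfold gradBeam
  fun_prop

theorem continuous_beamForm_self {X : Type*} [TopologicalSpace X] {U : X → Beamformers N J}
    {G : X → Matrix (Fin M) (Fin K) ℂ} (hU : Continuous U) (hG : Continuous G) :
    Continuous fun x => S.beamForm (G x) (U x) (U x) := by
  have := S.continuous_compound
  simp only [beamForm_apply, traceForm_apply, signalMap_apply, noiseMap_apply]
  fun_prop

theorem isClosed_feasibleBeamformers : IsClosed S.feasibleBeamformers := by
  simp only [feasibleBeamformers, Set.ofPred_forall]
  exact isClosed_iInter fun i => isClosed_le (by fun_prop) continuous_const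

section Differentiable

-- An auxiliary norm for the calculus; `IsStationaryPoint` refers only to the topology.
open scoped Matrix.Norms.Elementwise

variable {V : Type*} [NormedAddCommGroup V] [NormedSpace ℝ V] {l m n : Type*} [Fintype l]
  [Fintype m] [Fintype n]

theorem _root_.Differentiable.matrix_mul {A : V → Matrix l m ℂ} {B : V → Matrix m n ℂ}
    (hA : Differentiable ℝ A) (hB : Differentiable ℝ B) :
    Differentiable ℝ fun x => A x * B x := by
  refine differentiable_pi.2 fun i => differentiable_pi.2 fun j => ?_
  simp only [mul_apply]
  have hA' : ∀ k, Differentiable ℝ fun x => A x i k := fun k =>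
    differentiable_pi.1 (differentiable_pi.1 hA i) k
  have hB' : ∀ k, Differentiable ℝ fun x => B x k j := fun k =>
    differentiable_pi.1 (differentiable_pi.1 hB k) j
  exact Differentiable.fun_sum fun k _ => (hA' k).mul (hB' k)

theorem _root_.Differentiable.matrix_conjTranspose {A : V → Matrix l m ℂ}
    (hA : Differentiable ℝ A) : Differentiable ℝ fun x => (A x)ᴴ := by
  refine differentiable_pi.2 fun i => differentiable_pi.2 fun j => ?_
  exact (differentiable_pi.1 (differentiable_pi.1 hA j) i).star

theorem _root_.Differentiable.matrix_trace_re {A : V → Matrix l l ℂ}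
    (hA : Differentiable ℝ A) : Differentiable ℝ fun x => (A x).trace.re := by
  simp only [trace, diag, Complex.re_sum]
  exact Differentiable.fun_sum fun k _ =>
    Complex.reCLM.differentiable.comp (differentiable_pi.1 (differentiable_pi.1 hA k) k)

theorem differentiable_mse : Differentiable ℝ S.mse := by
  have hF : ∀ i, Differentiable ℝ fun x : Beamformers N J × Matrix (Fin M) (Fin K) ℂ => x.1 i :=
    fun i => differentiable_pi.1 differentiable_fst i
  have hG : Differentiable ℝ fun x : Beamformers N J × Matrix (Fin M) (Fin K) ℂ => x.2 :=
    differentiable_snd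
  have hc : ∀ {p q : ℕ} (A : Matrix (Fin p) (Fin q) ℂ),
      Differentiable ℝ fun _ : Beamformers N J × Matrix (Fin M) (Fin K) ℂ => A :=
    fun A => differentiable_const A
  have hT : Differentiable ℝ fun x : Beamformers N J × Matrix (Fin M) (Fin K) ℂ =>
      S.compound x.1 :=
    Differentiable.fun_sum fun i _ => ((hc _).matrix_mul (hF i)).matrix_mul (hc _)
  have hH := hG.matrix_conjTranspose
  have hTH := hT.matrix_conjTranspose
  refine Differentiable.matrix_trace_re ?_
  refine (((((((hH.matrix_mul hT).matrix_mul (hc _)).matrix_mul hTH).matrix_mul hG).sub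
    ((hH.matrix_mul hT).matrix_mul (hc _))).sub
    (((hc _).matrix_mul hTH).matrix_mul hG)).add
    (Differentiable.fun_sum fun i _ => ?_)).add ((hH.matrix_mul hG).const_smul ((S.σ₀ ^ 2 : ℝ) : ℂ))
    |>.add (hc _)
  exact (((((hH.matrix_mul (hc _)).matrix_mul (hF i)).matrix_mul (hc _)).matrix_mul
    (hF i).matrix_conjTranspose).matrix_mul (hc _)).matrix_mul hG

/-- The directional derivatives of the mean square error, when the receiver is optimal. -/
theorem exists_hasFDerivAt_mse {S : SensorNetwork L M K N J} (hsrc : S.srcCov.PosSemidef)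
    (hobs : ∀ i, (S.obsCov i).PosSemidef) {F : Beamformers N J} {G : Matrix (Fin M) (Fin K) ℂ}
    (hG : (S.compound F * S.srcCov * (S.compound F)ᴴ + S.noiseCov F) * G =
      S.compound F * S.srcCov) :
    ∃ f' : Beamformers N J × Matrix (Fin M) (Fin K) ℂ →L[ℝ] ℝ, HasFDerivAt S.mse f' (F, G) ∧
      ∀ y, f' y = 2 * S.slope F G y.1 := by
  obtain ⟨f', hf'⟩ := S.differentiable_mse (F, G)
  refine ⟨f', hf', fun y => ?_⟩
  -- An exact quadratic expansion along a line determines the derivative in that direction.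
  have line : ∀ (v : Beamformers N J × Matrix (Fin M) (Fin K) ℂ) (c q : ℝ),
      (∀ t : ℝ, S.mse ((F, G) + t • v) = S.mse (F, G) + t * c + t ^ 2 * q) → f' v = c := by
    intro v c q h
    have h1 : HasDerivAt (fun t : ℝ => S.mse ((F, G) + t • v)) (f' v) 0 := hf'.hasLineDerivAt v
    have h2 : HasDerivAt (fun t : ℝ => S.mse (F, G) + t * c + t ^ 2 * q) c 0 := by
      have := (((hasDerivAt_id (0 : ℝ)).mul_const c).const_add (S.mse (F, G))).add
        (((hasDerivAt_id (0 : ℝ)).pow 2).mul_const q)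
      exact this.congr_deriv (by simp)
    exact h1.unique (by simpa only [h] using h2)
  have hy : y = (y.1, 0) + (0, y.2) := by simp
  have hF := line (y.1, 0) (2 * S.slope F G y.1) (S.beamForm G y.1 y.1) fun t => by
    have := mse_add_beam hsrc hobs F (t • y.1) G
    simp only [map_smul, LinearMap.smul_apply, smul_eq_mul] at this
    simp only [Prod.smul_mk, Prod.mk_add_mk, smul_zero, add_zero]
    rw [this]
    ring
  obtain ⟨q, -, hq⟩ := exists_mse_add_receiver hsrc hobs hG y.2
  have hG' := line (0, y.2) 0 q fun t => by
    simp only [Prod.smul_mk, Prod.mk_add_mk, smul_zero, add_zero]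
    rw [hq]
    ring
  rw [hy, map_add, hF, hG']
  simp

end Differentiable

/-! ### Compactness -/

/-- Writing the observation covariance as `R Rᴴ` with `R` invertible turns the power constraint into
a Frobenius bound on `F R`. The feasible set is then closed in the image of a compact box under `Y ↦
Y R⁻¹`. -/
theorem isCompact_feasibleBeamformers (hW : ∀ i, (S.obsTotalCov i).PosDef) :
    IsCompact S.feasibleBeamformers := by
  have hR : ∀ i, ∃ R : Matrix (Fin (J i)) (Fin (J i)) ℂ, IsUnit R ∧ R * Rᴴ = S.obsTotalCov i := by
    intro i
    open scoped MatrixOrder in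
    have h1 : CFC.sqrt (S.obsTotalCov i) * CFC.sqrt (S.obsTotalCov i) = S.obsTotalCov i :=
      CFC.sqrt_mul_sqrt_self _ (hW i).posSemidef.nonneg
    refine ⟨CFC.sqrt (S.obsTotalCov i), ?_, ?_⟩
    · have := (hW i).isUnit
      rw [← h1] at this
      exact isUnit_of_mul_isUnit_left this
    · rw [(CFC.sqrt_nonneg (S.obsTotalCov i)).posSemidef.1.eq, h1]
  choose R hRu hR using hR
  have hc : IsCompact (Set.univ.pi fun i => (fun Y => Y * (R i)⁻¹) ''
      {Y : Matrix (Fin (N i)) (Fin (J i)) ℂ | ∀ a b, ‖Y a b‖ ≤ √(S.power i)}) :=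
    isCompact_univ_pi fun i => (isCompact_setOf_norm_le _).image (by fun_prop)
  refine hc.of_isClosed_subset S.isClosed_feasibleBeamformers fun F hF i _ => ?_
  refine ⟨F i * R i, fun a b => Real.le_sqrt_of_sq_le ?_, ?_⟩
  · refine (norm_sq_le_traceForm_one _ a b).trans (le_trans (le_of_eq ?_) (hF i))
    rw [traceForm_apply, ← hR i, Matrix.mul_one, conjTranspose_mul]
    simp only [Matrix.mul_assoc]
  · exact mul_nonsing_inv_cancel_right _ _ ((isUnit_iff_isUnit_det _).1 (hRu i))

/-! ### Descent of the inner loop -/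

variable {S}

/-- Expand the MSE around the new point: its slope towards the old point is nonnegative, so the drop
dominates the quadratic term, and that slope is itself at most the drop. The latter allows the
variational inequality to be based at the old block `F i` instead of the new one. -/
theorem IsBeamformerUpdate.descent (hsrc : S.srcCov.PosSemidef)
    (hobs : ∀ i, (S.obsCov i).PosSemidef) {F : Beamformers N J} {G : Matrix (Fin M) (Fin K) ℂ}
    {i : Fin L} (hW : (S.obsTotalCov i).PosDef) {X : Matrix (Fin (N i)) (Fin (J i)) ℂ}
    (h : S.IsBeamformerUpdate F G i X) (hF : F ∈ S.feasibleBeamformers) {F' : Beamformers N J}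
    (hF' : F' = Function.update F i X) :
    F' ∈ S.feasibleBeamformers ∧
      S.beamForm G (F' - F) (F' - F) ≤ S.mse (F, G) - S.mse (F', G) ∧
      ∀ Z ∈ S.feasibleBeamformers, 0 ≤ S.slope F' G (Pi.single i (Z i - F i)) +
        (S.mse (F, G) - S.mse (F', G)) := by
  obtain ⟨hX, hvi⟩ := h.slope_nonneg hsrc hobs hW
  rw [← hF'] at hvi
  have hd : F - F' = Pi.single i (F i - X) := by
    ext j : 1
    rw [hF']
    by_cases hj : j = i
    · subst hj; simp
    · simp [hj]
  have h0 := hvi (F i) (hF i)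
  rw [← hd] at h0
  have hm := mse_add_beam hsrc hobs F' (F - F') G
  rw [add_sub_cancel] at hm
  have hneg : S.beamForm G (F' - F) (F' - F) = S.beamForm G (F - F') (F - F') := by
    rw [← neg_sub F F']; simp only [map_neg, LinearMap.neg_apply, neg_neg]
  have hq := beamForm_self_nonneg hsrc hobs G (F - F')
  refine ⟨fun j => ?_, by linarith, fun Z hZ => ?_⟩
  · rw [hF']
    by_cases hj : j = i
    · subst hj; rw [Function.update_self]; exact hX
    · simpa [hj] using hF j
  · have hz := hvi (Z i) (hZ i)
    have : (Pi.single i (Z i - X) : Beamformers N J) =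
        Pi.single i (Z i - F i) + (F - F') := by
      rw [hd, ← Pi.single_add, sub_add_sub_cancel]
    rw [this, map_add] at hz
    linarith

/-- A pass of the inner loop from a feasible point decreases the mean square error, by an amount
that bounds how far the variational inequalities are violated at the starting point. -/
theorem IsSweep.descent (hsrc : S.srcCov.PosSemidef)
    (hobs : ∀ i, (S.obsCov i).PosSemidef) (hW : ∀ i, (S.obsTotalCov i).PosDef)
    {F F' : Beamformers N J} {G : Matrix (Fin M) (Fin K) ℂ}
    (h : S.IsSweep G F F') (hF : F ∈ S.feasibleBeamformers) :
    F' ∈ S.feasibleBeamformers ∧ S.mse (F', G) ≤ S.mse (F, G) ∧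
      ∀ (i : Fin L), ∀ Z ∈ S.feasibleBeamformers,
        0 ≤ S.slope F G (Pi.single i (Z i - F i)) +
          L * (√(S.mse (F, G) - S.mse (F', G)) *
            √(S.beamForm G (Pi.single i (Z i - F i)) (Pi.single i (Z i - F i)))) +
          (S.mse (F, G) - S.mse (F', G)) := by
  obtain ⟨Y, h0, hL, hY⟩ := h
  have hfeas : ∀ k, Y k ∈ S.feasibleBeamformers := by
    intro k
    induction k using Fin.induction with
    | zero => exact h0 ▸ hF
    | succ i ih =>
      obtain ⟨X, hX, hX'⟩ := hY i
      exact (hX.descent hsrc hobs (hW i) ih hX').1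
  have hstep : ∀ i : Fin L, S.beamForm G (Y i.succ - Y i.castSucc) (Y i.succ - Y i.castSucc) ≤
      S.mse (Y i.castSucc, G) - S.mse (Y i.succ, G) := fun i => by
    obtain ⟨X, hX, hX'⟩ := hY i
    exact (hX.descent hsrc hobs (hW i) (hfeas _) hX').2.1
  have hvi : ∀ i : Fin L, ∀ Z ∈ S.feasibleBeamformers,
      0 ≤ S.slope (Y i.succ) G (Pi.single i (Z i - Y i.castSucc i)) +
        (S.mse (Y i.castSucc, G) - S.mse (Y i.succ, G)) := fun i => by
    obtain ⟨X, hX, hX'⟩ := hY i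
    exact (hX.descent hsrc hobs (hW i) (hfeas _) hX').2.2
  have hanti : Antitone fun k => S.mse (Y k, G) := Fin.antitone_iff_succ_le.2 fun i => by
    linarith [hstep i, beamForm_self_nonneg hsrc hobs G (Y i.succ - Y i.castSucc)]
  have hle : ∀ k, S.mse (Y k, G) ≤ S.mse (F, G) := fun k => h0 ▸ hanti (Fin.zero_le k)
  have hge : ∀ k, S.mse (F', G) ≤ S.mse (Y k, G) := fun k => hL ▸ hanti (Fin.le_last k)
  -- Each of the `k` updates moves by at most the square root of the total drop in the seminorm of
  -- `beamForm`.
  have hdist : ∀ (U : Beamformers N J) (k : Fin (L + 1)), S.beamForm G (Y k - F) U ≤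
      (k : ℕ) * (√(S.mse (F, G) - S.mse (F', G)) * √(S.beamForm G U U)) := by
    intro U k
    induction k using Fin.induction with
    | zero => simp [h0]
    | succ i ih =>
      have h1 : S.beamForm G (Y i.succ - Y i.castSucc) U ≤
          √(S.mse (F, G) - S.mse (F', G)) * √(S.beamForm G U U) := by
        rw [← Real.sqrt_mul (by linarith [hle 0, hge 0])]
        refine Real.le_sqrt_of_sq_le ((beamForm_sq_le hsrc hobs G _ U).trans ?_)
        refine mul_le_mul_of_nonneg_right ?_ (beamForm_self_nonneg hsrc hobs G U)
        linarith [hstep i, hle i.castSucc, hge i.succ]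
      rw [← sub_add_sub_cancel (Y i.succ) (Y i.castSucc) F, map_add, LinearMap.add_apply]
      simp only [Fin.val_castSucc, Fin.val_succ, Nat.cast_add, Nat.cast_one] at ih ⊢
      linarith
  -- Block `i` still has its initial value when its turn comes.
  have hfix : ∀ i k : Fin L, k ≤ i → Y k.castSucc i = F i := by
    intro i k
    obtain ⟨k, hk⟩ := k
    induction k with
    | zero => intro _; exact congrFun h0 i
    | succ k ih =>
      intro hki
      obtain ⟨X, -, hX⟩ := hY ⟨k, by omega⟩
      have hlt : (⟨k, by omega⟩ : Fin L) < i := lt_of_lt_of_le (by simp [Fin.lt_def]) hki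
      change Y (Fin.succ ⟨k, by omega⟩) i = F i
      rw [hX, Function.update_of_ne hlt.ne']
      exact ih _ hlt.le
  refine ⟨hL ▸ hfeas _, hL ▸ hle _, fun i Z hZ => ?_⟩
  have h1 := hvi i Z hZ
  rw [hfix i i le_rfl] at h1
  set U : Beamformers N J := Pi.single i (Z i - F i)
  -- Transport the inequality from the point after update `i` back to the start `F`. At most `L`
  -- updates lie in between, hence the factor `L`.
  have h2 := S.slope_add F (Y i.succ - F) U G
  rw [add_sub_cancel] at h2
  have h3 := hdist U i.succ
  have h4 : (((i.succ : Fin (L + 1)) : ℕ) : ℝ) ≤ L := by exact_mod_cast i.succ.is_le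
  have h5 := mul_le_mul_of_nonneg_right h4 (mul_nonneg
    (Real.sqrt_nonneg (S.mse (F, G) - S.mse (F', G))) (Real.sqrt_nonneg (S.beamForm G U U)))
  linarith [hle i.castSucc, hge i.succ]

/-- Passes never increase the MSE, so every outcome is at least as good as the first pass. For a
limit point this follows by continuity. -/
theorem IsInnerLoop.exists_sweep (hsrc : S.srcCov.PosSemidef)
    (hobs : ∀ i, (S.obsCov i).PosSemidef) (hW : ∀ i, (S.obsTotalCov i).PosDef)
    {F F' : Beamformers N J} {G : Matrix (Fin M) (Fin K) ℂ}
    (h : S.IsInnerLoop G F F') (hF : F ∈ S.feasibleBeamformers) :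
    F' ∈ S.feasibleBeamformers ∧ ∃ F₁, S.IsSweep G F F₁ ∧ S.mse (F', G) ≤ S.mse (F₁, G) := by
  rcases h with h | ⟨Y, h0, hY, φ, hφ, hlim⟩
  · induction h with
    | single h => exact ⟨(h.descent hsrc hobs hW hF).1, _, h, le_rfl⟩
    | tail _ h ih =>
      obtain ⟨hb, F₁, h1, h2⟩ := ih
      have := h.descent hsrc hobs hW hb
      exact ⟨this.1, F₁, h1, this.2.1.trans h2⟩
  · have hfeas : ∀ n, Y n ∈ S.feasibleBeamformers := by
      intro n
      induction n with
      | zero => exact h0 ▸ hF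
      | succ n ih => exact ((hY n).descent hsrc hobs hW ih).1
    have hanti : Antitone fun n => S.mse (Y n, G) :=
      antitone_nat_of_succ_le fun n => ((hY n).descent hsrc hobs hW (hfeas n)).2.1
    refine ⟨S.isClosed_feasibleBeamformers.mem_of_tendsto hlim (Eventually.of_forall fun n =>
      hfeas _), Y 1, h0 ▸ hY 0, ?_⟩
    refine le_of_tendsto ((S.continuous_mse.tendsto (F', G)).comp (hlim.prodMk_nhds
      tendsto_const_nhds)) ?_
    -- Index `0` is excluded, since the start may have a larger MSE than the first pass.
    filter_upwards [eventually_ge_atTop 1] with n hn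
    exact hanti (hn.trans (hφ.id_le n))

end SensorNetwork

/-! ### Limit points of the outer loop -/

theorem theorem4 {L M K : ℕ} {N J : Fin L → ℕ} (S : SensorNetwork L M K N J)
    (hsrc : S.srcCov.PosSemidef) (hobs : ∀ i, (S.obsCov i).PosSemidef)
    (hσ : 0 < S.σ₀) (hpow : ∀ i, 0 < S.power i)
    (hpos : ∀ i, (S.obs i * S.srcCov * (S.obs i)ᴴ).PosDef ∨ (S.obsCov i).PosDef)
    (x : ℕ → Beamformers N J × Matrix (Fin M) (Fin K) ℂ) (hx : S.IsLayeredBCD x) :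
    Antitone (fun j => S.mse (x j)) ∧
      (∃ y, IsLimitPoint y x) ∧
      ∀ y, IsLimitPoint y x → IsStationaryPoint S.mse S.feasibleSet y := by
  have hW := SensorNetwork.obsTotalCov_posDef hsrc hobs hpos
  obtain ⟨hx0, hwien, hloop⟩ := hx
  have hfeas : ∀ j, (x j).1 ∈ S.feasibleBeamformers := by
    intro j
    induction j with
    | zero => exact hx0
    | succ j ih => exact ((hloop j).exists_sweep hsrc hobs hW ih).1
  have hrec : ∀ j F, S.mse (x j) ≤ S.mse ((x j).1, F) := fun j F => by
    have := SensorNetwork.mse_wiener_le hsrc hobs hσ (x j).1 F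
    rwa [← hwien] at this
  choose F₁ hsweep hF₁ using fun j => ((hloop j).exists_sweep hsrc hobs hW (hfeas j)).2
  have hnext : ∀ j, S.mse (x (j + 1)) ≤ S.mse (F₁ j, (x j).2) := fun j =>
    (hrec (j + 1) _).trans (hF₁ j)
  have hanti : Antitone fun j => S.mse (x j) := antitone_nat_of_succ_le fun j =>
    (hnext j).trans ((hsweep j).descent hsrc hobs hW (hfeas j)).2.1
  refine ⟨hanti, ?_, ?_⟩
  · have hG : IsCompact (conjTranspose '' {A : Matrix (Fin K) (Fin M) ℂ |
        ∀ a b, ‖A a b‖ ≤ √(S.mse (x 0) / S.σ₀ ^ 2)}) :=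
      (isCompact_setOf_norm_le _).image (by fun_prop)
    have hmem : ∀ j, x j ∈ S.feasibleBeamformers ×ˢ (conjTranspose ''
        {A : Matrix (Fin K) (Fin M) ℂ | ∀ a b, ‖A a b‖ ≤ √(S.mse (x 0) / S.σ₀ ^ 2)}) := by
      refine fun j => ⟨hfeas j, (x j).2ᴴ, fun a b => Real.le_sqrt_of_sq_le ?_,
        conjTranspose_conjTranspose _⟩
      rw [le_div_iff₀' (by positivity)]
      calc _ ≤ S.σ₀ ^ 2 * traceForm 1 (x j).2ᴴ (x j).2ᴴ := by
            gcongr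
            exact norm_sq_le_traceForm_one _ a b
        _ ≤ S.mse (x j) := SensorNetwork.traceForm_receiver_le_mse hsrc hobs (x j).1 _
        _ ≤ S.mse (x 0) := hanti (Nat.zero_le j)
    have : ∀ p q : ℕ, FirstCountableTopology (Matrix (Fin p) (Fin q) ℂ) := fun p q =>
      inferInstanceAs (FirstCountableTopology (Fin p → Fin q → ℂ))
    obtain ⟨y, -, φ, hφ, hlim⟩ :=
      ((S.isCompact_feasibleBeamformers hW).prod hG).tendsto_subseq hmem
    exact ⟨y, φ, hφ, hlim⟩
  · rintro y ⟨φ, hφ, hlim⟩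
    have hy : y.1 ∈ S.feasibleBeamformers :=
      S.isClosed_feasibleBeamformers.mem_of_tendsto ((continuous_fst.tendsto y).comp hlim)
        (Eventually.of_forall fun n => hfeas _)
    have hG : (S.compound y.1 * S.srcCov * (S.compound y.1)ᴴ + S.noiseCov y.1) * y.2 =
        S.compound y.1 * S.srcCov := by
      have hc := S.continuous_compound
      have hcl : IsClosed {z : Beamformers N J × Matrix (Fin M) (Fin K) ℂ |
          (S.compound z.1 * S.srcCov * (S.compound z.1)ᴴ + S.noiseCov z.1) * z.2 =
            S.compound z.1 * S.srcCov} := by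
        unfold SensorNetwork.noiseCov
        exact isClosed_eq (by fun_prop) (by fun_prop)
      refine hcl.mem_of_tendsto hlim (Eventually.of_forall fun n => ?_)
      change _ * (x (φ n)).2 = _
      rw [hwien]
      exact SensorNetwork.receiverCov_mul_wiener hsrc hobs hσ _
    -- The drop is taken to the next outer iterate `φ n + 1`, which need not belong to the
    -- subsequence; convergence of the whole MSE sequence is what is used.
    have hdiff : Tendsto (fun n => S.mse (x (φ n)) - S.mse (x (φ n + 1))) atTop (𝓝 0) := by
      have hbdd : BddBelow (Set.range fun j => S.mse (x j)) :=
        ⟨0, by rintro _ ⟨j, rfl⟩; exact SensorNetwork.mse_nonneg hsrc hobs _ _⟩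
      have ht := tendsto_atTop_ciInf hanti hbdd
      have := (ht.sub (ht.comp (tendsto_add_atTop_nat 1))).comp hφ.tendsto_atTop
      rwa [sub_self] at this
    have hblock : ∀ i, ∀ Z ∈ S.feasibleBeamformers,
        0 ≤ S.slope y.1 y.2 (Pi.single i (Z i - y.1 i)) := by
      intro i Z hZ
      have hc1 : Continuous fun z : Beamformers N J × Matrix (Fin M) (Fin K) ℂ =>
          S.slope z.1 z.2 (Pi.single i (Z i - z.1 i)) := by
        simp only [SensorNetwork.slope_single]
        have := S.continuous_gradBeam i
        fun_prop
      have hc2 : Continuous fun z : Beamformers N J × Matrix (Fin M) (Fin K) ℂ =>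
          S.beamForm z.2 (Pi.single i (Z i - z.1 i)) (Pi.single i (Z i - z.1 i)) :=
        S.continuous_beamForm_self ((continuous_single i).comp (by fun_prop)) continuous_snd
      have hlim' := (((hc1.tendsto y).comp hlim).add ((hdiff.sqrt.mul
        ((hc2.tendsto y).comp hlim).sqrt).const_mul (L : ℝ))).add hdiff
      simp only [Real.sqrt_zero, zero_mul, mul_zero, add_zero] at hlim'
      refine ge_of_tendsto' hlim' fun n => ?_
      have h1 := ((hsweep (φ n)).descent hsrc hobs hW (hfeas _)).2.2 i Z hZ
      have h2 : S.mse (x (φ n)) - S.mse (F₁ (φ n), (x (φ n)).2) ≤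
        S.mse (x (φ n)) - S.mse (x (φ n + 1)) := by linarith [hnext (φ n)]
      -- The error bound increases with the drop, so the drop of the first pass may be replaced by
      -- that of the outer iteration.
      refine h1.trans ?_
      simp only [Function.comp_apply]
      gcongr
    obtain ⟨f', hf', hf⟩ := SensorNetwork.exists_hasFDerivAt_mse hsrc hobs hG
    refine ⟨hy, f', hf', fun z hz => ?_⟩
    rw [hf]
    -- The feasible set is a product over the blocks, so the block inequalities suffice.
    have hsum : (z - y).1 = ∑ i, Pi.single i (z.1 i - y.1 i) :=
      (Finset.univ_sum_single (z.1 - y.1)).symm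
    rw [hsum, map_sum]
    exact mul_nonneg zero_le_two (Finset.sum_nonneg fun i _ => hblock i z.1 hz)
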